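/- Let $r\ge 1$, let $\mathcal F$ be the set of front faces of $[0,1]^r$ (the faces containing the origin; they include $\{0\}$ and $[0,1]^r$), and let $V=\{0,1\}^r$. **Conditions on $a,b$.** Let $1\le k\le r$, and let $a\colon\mathcal F\to(0,\infty)$ and $b\colon\mathcal F\to[0,\infty)$ satisfy condition $\mathrm{NC}_k$: (i) $b(F)\le b(F')$ whenever $F\subset F'$; (ii) $(a(F),b(F))=(1,\dim F)$ whenever $\dim F\le k$; (iii) if $b$ is eventually constant at $F$, then $\sum_{F'\supset F}(-1)^{\dim F'-\dim F}a(F')\ge 0$. Here $b$ is called *increasing at* $F$ (resp. *eventually constant at* $F$) if $b(F)<b(F')$ (resp. $b(F)=b(F')$) for every front face $F'\supsetneq F$. Assume that at every $F\in\mathcal F$ the map $b$ is increasing or eventually constant. **Vertex copulas.** For $u\in(0,1)^r$ the vertex decomposition $\mathcal J(u)$ consists of the boxes $\prod_i I_i$ with $I_i=[0,u_i]$ or $I_i=[u_i,1]$, indexed by $\nu\in V$ ($\nu_i=0$ or $\nu_i=1$ respectively). A vertex copula of order $k$ with respect to $u$ is a probability measure on $[0,1]^r$ that is uniform on each box of $\mathcal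 J(u)$ and whose projection to every $k$-dimensional front face is the uniform probability measure. **Tail nesting.** Let $z$ be a vertex copula of order $k$ with respect to $u$, and let $c$ be a measure that is uniform on each box of a grid $\mathcal J$ of $[0,1]^r$. For $J\in\mathcal J$ let $A(J)$ be the set of coordinates $i$ for which the $i$-th edge of $J$ contains $0$. Then $\mathrm{tnest}(z,c)$ is obtained by replacing $c$ on every box $J\in\mathcal J$ by $c(J)$ times the image, under the canonical affine map $[0,1]^r\to J$, of the product of the projection of $z$ to the coordinates in $A(J)$ with the uniform probability measure in the remaining coordinates; its grid is obtained from $\mathcal J$ by subdividing each box by the image of $\mathcal J(u)$. For a sequence $(z_n)_{n\ge1}$ of vertex copulas of order $k$ (with respect to points $u^{(n)}\in(0,1)^r$) put $c^1=z_1$ and $c^n=\mathrm{tnest}(z_n,c^{n-1})$; $\mathrm{tnest}((z_n))$ denotes the limit measure $c^\infty$ of the $c^n$, i.e. $c^\infty(E)=\lim_n c^n(E)$ for all Borel sets $E$. **Tail degree.** For a probability measure $c$ on $[0,1]^r$ and $F\in\mathcal F$ let $c_F$ be the push-forward of $c$ under the projection to $F\cong[0,1]^{\dim F}$, and let $$\mathrm{tdeg}_c(F)=\inf\Bigl\{\tau\in\mathbb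 R : \liminf_{s\downarrow0}\frac{c_F(s[0,1]^{\dim F})}{s^\tau}=\infty\Bigr\}.$$ **Claim.** For every sequence in $(0,1]$ converging to $0$ there are a subsequence $(s_n)_{n\ge1}$ and a sequence $(z_n)_{n\ge1}$ of vertex copulas of order $k$ such that the limit $c^\infty=\mathrm{tnest}((z_n))$ exists and, for every $F\in\mathcal F$, $$\lim_{n\to\infty}\frac{c^\infty_F\bigl(s_n[0,1]^{\dim F}\bigr)}{s_n^{\,b(F)}}=a(F)\qquad\text{and}\qquad \mathrm{tdeg}_{c^\infty}(F)=b(F).$$ -/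

import Mathlib

open Filter Topology MeasureTheory
open scoped ENNReal

noncomputable section

namespace TailNest

/-- A front face of the unit cube `[0,1]^r` is given by the set of its free coordinates, so that
its dimension is the cardinality and inclusion of faces is inclusion of sets. -/
abbrev Face (r : ℕ) : Type := Finset (Fin r)

/-- A vertex of `[0,1]^r`; `true` stands for the coordinate `1`, `false` for `0`. -/
abbrev Vertex (r : ℕ) : Type := Fin r → Bool

/-! ### Maps on the front faces -/

/-- `b` is increasing at the face `F`. -/
def IncreasingAt {r : ℕ} (b : Face r → ℝ) (F : Face r) : Prop :=
  ∀ F' : Face r, F ⊂ F' → b F < b F'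

/-- `b` is eventually constant at the face `F`. -/
def EventuallyConstAt {r : ℕ} (b : Face r → ℝ) (F : Face r) : Prop :=
  ∀ F' : Face r, F ⊂ F' → b F = b F'

/-- The condition `NC_k` for positive `a` and non-negative `b`
(that `b ≥ 0` follows from the first two clauses, as `b` is `0` at the origin). -/
structure NC {r : ℕ} (k : ℕ) (a b : Face r → ℝ) : Prop where
  pos : ∀ F, 0 < a F
  mono : ∀ F F' : Face r, F ⊆ F' → b F ≤ b F'
  low : ∀ F : Face r, F.card ≤ k → a F = 1 ∧ b F = F.card
  alt : ∀ F : Face r, EventuallyConstAt b F →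
    0 ≤ ∑ F' ∈ Finset.univ.filter (fun F' : Face r => F ⊆ F'),
      (-1 : ℝ) ^ (F'.card - F.card) * a F'

/-! ### Tail degrees -/

/-- `c_F`: the push-forward of `c` under the projection of the cube onto its front face `F`. -/
def faceMeasure {r : ℕ} (c : Measure (Fin r → ℝ)) (F : Face r) : Measure (F → ℝ) :=
  c.map (fun x (i : F) => x i)

/-- `c_F (s [0,1]^{dim F})`. -/
def tailMass {r : ℕ} (c : Measure (Fin r → ℝ)) (F : Face r) (s : ℝ) : ℝ≥0∞ :=
  faceMeasure c F (Set.Icc (fun _ => 0) (fun _ => s))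

/-- The tail degree of `c_F`: the infimum, in `[-∞, ∞]`, of all real `τ` with
`liminf_{s → 0+} c_F (s [0,1]^{dim F}) / s^τ = ∞`. -/
def tailDegree {r : ℕ} (c : Measure (Fin r → ℝ)) (F : Face r) : EReal :=
  sInf {x : EReal | ∃ τ : ℝ, x = (τ : EReal) ∧
    liminf (fun s : ℝ => tailMass c F s / ENNReal.ofReal (s ^ τ)) (𝓝[>] 0) = ⊤}

/-! ### Vertex copulas -/

/-- The masses which the uniform probability measure gives to the boxes of the vertex
decomposition of the cube induced by `u`. -/
def unifVertex {r : ℕ} (u : Fin r → ℝ) (ν : Vertex r) : ℝ :=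
  ∏ i, if ν i then 1 - u i else u i

/-- Projection of a vertex measure `x` onto the front face with free coordinates `K`,
evaluated at the vertex of that face which has the coordinates `μ i`, `i ∈ K`. -/
def vertexProj {r : ℕ} (K : Face r) (x : Vertex r → ℝ) (μ : Vertex r) : ℝ :=
  ∑ ν ∈ Finset.univ.filter (fun ν : Vertex r => ∀ i ∈ K, ν i = μ i), x ν

/-- `G_k(V)`: the vertex measures which project to zero on each face of dimension `k`. -/
def vertexGenerators (r k : ℕ) : Set (Vertex r → ℝ) :=
  {x | ∀ K : Face r, K.card = k → ∀ μ, vertexProj K x μ = 0}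

/-- `C_k(u) = (unif_u + G_k(V)) ∩ [0,1]^V`: the vertex copulas of order `k` for `u`. -/
def vertexCopulas {r : ℕ} (k : ℕ) (u : Fin r → ℝ) : Set (Vertex r → ℝ) :=
  {z | (∀ ν, z ν ∈ Set.Icc (0 : ℝ) 1) ∧ z - unifVertex u ∈ vertexGenerators r k}

/-! ### Box measures and nesting -/

/-- A box measure: a finite family of boxes `[lo j, hi j]`, each with the total mass that is
spread uniformly over it. -/
structure BoxMeasure (r : ℕ) where
  ι : Type
  [fintypeι : Fintype ι]
  lo : ι → Fin r → ℝ
  hi : ι → Fin r → ℝ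
  mass : ι → ℝ

attribute [instance] BoxMeasure.fintypeι

/-- The Borel measure given by a box measure with non-negative masses. -/
def BoxMeasure.toMeasure {r : ℕ} (c : BoxMeasure r) : Measure (Fin r → ℝ) :=
  ∑ j, ENNReal.ofReal (c.mass j) •
    ProbabilityTheory.cond (volume : Measure (Fin r → ℝ)) (Set.Icc (c.lo j) (c.hi j))

/-- Nesting, for every box `j` of `c`, the box measure `w j` on the unit cube into that box: the
image of `w j` under the canonical affine map from the cube onto the box, scaled by the mass of
the box. -/
def BoxMeasure.nest {r : ℕ} (c : BoxMeasure r) (w : c.ι → BoxMeasure r) : BoxMeasure r where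
  ι := Σ j : c.ι, (w j).ι
  lo p i := c.lo p.1 i + (w p.1).lo p.2 i * (c.hi p.1 i - c.lo p.1 i)
  hi p i := c.lo p.1 i + (w p.1).hi p.2 i * (c.hi p.1 i - c.lo p.1 i)
  mass p := c.mass p.1 * (w p.1).mass p.2

/-- The box measure on the vertex decomposition induced by `u` with masses `x`: the box of the
vertex `ν` is the product of the intervals `[0, u i]` (if `ν i = 0`) and `[u i, 1]` (if
`ν i = 1`). -/
def vertexBoxMeasure {r : ℕ} (u : Fin r → ℝ) (x : Vertex r → ℝ) : BoxMeasure r where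
  ι := Vertex r
  lo ν i := if ν i then u i else 0
  hi ν i := if ν i then 1 else u i
  mass := x

/-- The product of the projection of the vertex copula `z` onto the front face with free
coordinates `A` and the uniform copula in the remaining coordinates, as a vertex measure. -/
def projTimesUnif {r : ℕ} (A : Face r) (u : Fin r → ℝ) (z : Vertex r → ℝ) (μ : Vertex r) : ℝ :=
  vertexProj A z μ * ∏ i ∈ Aᶜ, if μ i then 1 - u i else u i

open Classical in
/-- For a box of a grid of the unit cube, the free coordinates of the largest front face onto
which the box projects as the box at the origin. -/
def BoxMeasure.originCoords {r : ℕ} (c : BoxMeasure r) (j : c.ι) : Face r :=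
  Finset.univ.filter (fun i => c.lo j i = 0)

/-- Tail nesting of the vertex copula `z ∈ C_k(u)` into the grid measure `c`. -/
def tnest {r : ℕ} (u : Fin r → ℝ) (z : Vertex r → ℝ) (c : BoxMeasure r) : BoxMeasure r :=
  c.nest fun j => vertexBoxMeasure u (projTimesUnif (c.originCoords j) u z)

/-- Iterated tail nesting of a sequence of vertex copulas: the first grid measure is the first
vertex copula, and each later vertex copula is tail nested into the grid measure before it. -/
def tnestIter {r : ℕ} (u : ℕ → Fin r → ℝ) (z : ℕ → Vertex r → ℝ) : ℕ → BoxMeasure r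
  | 0 => vertexBoxMeasure (u 0) (z 0)
  | n + 1 => tnest (u (n + 1)) (z (n + 1)) (tnestIter u z n)

/-- `c` is the limit `tnest((z_n))` of the iterated tail nestings: their measures converge to `c`
on every Borel set. This determines `c`, and it makes `c` a probability measure on the cube if the
iterated tail nestings are. -/
def IsTailNesting {r : ℕ} (u : ℕ → Fin r → ℝ) (z : ℕ → Vertex r → ℝ)
    (c : Measure (Fin r → ℝ)) : Prop :=
  ∀ E : Set (Fin r → ℝ), MeasurableSet E →
    Tendsto (fun n => (tnestIter u z n).toMeasure E) atTop (𝓝 (c E))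

end TailNest

end

/-!
Nesting with the same division ratio `q n` in every coordinate leads after the steps `0, …, n` to
boxes at the origin of side `S n = q 0 * ⋯ * q n`, and the mass of the corner `x i ≤ S n`, `i ∈ F`, is then
the product over the steps `i ≤ n` of the masses `p i F` which the projections of the vertex copulas
`z i` onto `F` have at the origin (`IsCornerGrid.cornerMass_tnest`). Later steps do not change it.

A vertex measure with prescribed corner masses `p F` exists and is unique by Möbius inversion on the
lattice of faces (`cornerInversion`); it projects to the uniform measure on the faces of dimension
`k` if `p F = q ^ |F|` for `|F| ≤ k`. With `p 0 F = a F * q 0 ^ b F` and `p n F = q n ^ b F` for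
later steps, the corner mass of `F` at the scale `S n` is exactly `a F * S n ^ b F`. Non-negativity
of the inversion holds for small ratios (`eventually_cornerInversion_nonneg`): where `b` is
increasing, one term dominates; where it is eventually constant, the alternating sum of the
coefficients decides, which is non-negative by assumption for `a`, and for the constant `1` anyway.

After passing to a quickly decreasing subsequence of the given scales, intermediate scales are
inserted so that the ratios `q n` also stay above a positive constant (`exists_ratios`). Then the
tail mass, being monotone in the scale, is bounded below by a multiple of the power `b F` at all
small scales, which gives the tail degree (`sInf_tail_eq`).

The iterated nestings converge on every Borel set because a nesting step changes the measure only
where some coordinate is at most `S n`, and this region has mass at most `r * S n`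
(`exists_tendsto_measure`, `exists_isTailNesting`).
-/

noncomputable section

namespace TailNest

variable {r : ℕ}

/-! ### Inversion on the lattice of front faces -/

/-- The face of the coordinates in which the vertex `ν` is `0`. -/
def zeroFace (ν : Vertex r) : Face r := Finset.univ.filter fun i => ν i = false

@[simp]
lemma mem_zeroFace {ν : Vertex r} {i : Fin r} : i ∈ zeroFace ν ↔ ν i = false := by
  simp [zeroFace]

/-- The coefficient of `p F` in the Möbius inversion on the lattice of front faces, as a product
over the coordinates: it is `(-1) ^ (|F| - |zeroFace ν|)` if `zeroFace ν ⊆ F` and `0` otherwise. -/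
def inversionWeight (F : Face r) (ν : Vertex r) : ℝ :=
  ∏ i, if i ∈ F then (if ν i then -1 else 1) else (if ν i then 1 else 0)

/-- The vertex measure whose projection onto each front face `F` has mass `p F` at the origin. -/
def cornerInversion (p : Face r → ℝ) (ν : Vertex r) : ℝ :=
  ∑ F, p F * inversionWeight F ν

/-- Summing a product over the vertices of a fibre of the projection onto the face `K`. -/
lemma sum_filter_prod {R : Type*} [CommSemiring R] (K : Face r) (μ : Vertex r)
    (g : Fin r → Bool → R) :
    ∑ ν ∈ Finset.univ.filter (fun ν : Vertex r => ∀ i ∈ K, ν i = μ i), ∏ i, g i (ν i) =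
      ∏ i, if i ∈ K then g i (μ i) else g i true + g i false := by
  have h : (Finset.univ.filter (fun ν : Vertex r => ∀ i ∈ K, ν i = μ i)) =
      Fintype.piFinset (fun i => if i ∈ K then {μ i} else Finset.univ) := by
    ext ν
    simp only [Finset.mem_filter, Finset.mem_univ, true_and, Fintype.mem_piFinset]
    refine forall_congr' fun i => ?_
    by_cases hi : i ∈ K <;> simp [hi]
  rw [h, ← Finset.prod_univ_sum]
  refine Finset.prod_congr rfl fun i _ => ?_
  by_cases hi : i ∈ K <;> simp [hi]

lemma vertexProj_inversionWeight (K F : Face r) (μ : Vertex r) :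
    vertexProj K (inversionWeight F) μ =
      ∏ i, if i ∈ K then
        (if i ∈ F then (if μ i then -1 else 1) else (if μ i then 1 else 0))
        else (if i ∈ F then 0 else 1) := by
  unfold vertexProj inversionWeight
  rw [sum_filter_prod K μ fun i x =>
    if i ∈ F then (if x then (-1 : ℝ) else 1) else (if x then 1 else 0)]
  refine Finset.prod_congr rfl fun i _ => ?_
  by_cases hi : i ∈ F <;> simp [hi]

lemma vertexProj_cornerInversion (p : Face r → ℝ) (K : Face r) (μ : Vertex r) :
    vertexProj K (cornerInversion p) μ = ∑ F, p F * vertexProj K (inversionWeight F) μ := by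
  simp only [vertexProj, cornerInversion, Finset.mul_sum]
  exact Finset.sum_comm

/-- The defining property of `cornerInversion`. -/
lemma vertexProj_cornerInversion_zero (p : Face r → ℝ) (K : Face r) :
    vertexProj K (cornerInversion p) (fun _ => false) = p K := by
  rw [vertexProj_cornerInversion, Finset.sum_eq_single K]
  · rw [vertexProj_inversionWeight, Finset.prod_eq_one, mul_one]
    intro i _
    by_cases hi : i ∈ K <;> simp [hi]
  · intro F _ hF
    rw [vertexProj_inversionWeight]
    obtain ⟨i, hi⟩ : ∃ i, ¬ (i ∈ F ↔ i ∈ K) := by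
      by_contra! h
      exact hF (Finset.ext h)
    rw [Finset.prod_eq_zero (Finset.mem_univ i), mul_zero]
    by_cases h1 : i ∈ K <;> by_cases h2 : i ∈ F <;> simp_all
  · simp

lemma sum_cornerInversion (p : Face r → ℝ) : ∑ ν, cornerInversion p ν = p ∅ := by
  simpa [vertexProj] using vertexProj_cornerInversion_zero p ∅

lemma unifVertex_eq_cornerInversion (u : Fin r → ℝ) :
    unifVertex u = cornerInversion fun F => ∏ i ∈ F, u i := by
  ext ν
  have h : unifVertex u ν =
      ∏ i, ((if ν i then -u i else u i) + (if ν i then (1 : ℝ) else 0)) := by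
    refine Finset.prod_congr rfl fun i _ => ?_
    cases ν i <;> simp [sub_eq_neg_add]
  rw [h, Fintype.prod_add]
  refine Finset.sum_congr rfl fun F _ => ?_
  rw [inversionWeight, ← Finset.prod_mul_prod_compl F (fun i => if i ∈ F then _ else _),
    ← mul_assoc, ← Finset.prod_mul_distrib]
  congr 1
  · refine Finset.prod_congr rfl fun i hi => ?_
    cases ν i <;> simp [hi]
  · refine Finset.prod_congr rfl fun i hi => ?_
    rw [if_neg (Finset.mem_compl.1 hi)]

/-- The projection of `cornerInversion p` onto a face depends only on the values of `p` at the
subfaces of that face. -/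
lemma vertexProj_cornerInversion_congr {p p' : Face r → ℝ} {K : Face r}
    (h : ∀ F ⊆ K, p F = p' F) (μ : Vertex r) :
    vertexProj K (cornerInversion p) μ = vertexProj K (cornerInversion p') μ := by
  rw [vertexProj_cornerInversion, vertexProj_cornerInversion]
  refine Finset.sum_congr rfl fun F _ => ?_
  by_cases hF : F ⊆ K
  · rw [h F hF]
  · obtain ⟨i, hiF, hiK⟩ := Finset.not_subset.1 hF
    rw [vertexProj_inversionWeight, Finset.prod_eq_zero (Finset.mem_univ i) (by simp [hiF, hiK]),
      mul_zero, mul_zero]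

lemma cornerInversion_mem_vertexCopulas {k : ℕ} {u : Fin r → ℝ} {p : Face r → ℝ}
    (hlow : ∀ F : Face r, F.card ≤ k → p F = ∏ i ∈ F, u i)
    (hnn : ∀ ν, 0 ≤ cornerInversion p ν) : cornerInversion p ∈ vertexCopulas k u := by
  refine ⟨fun ν => ⟨hnn ν, ?_⟩, fun K hK μ => ?_⟩
  · have h1 : ∑ ν, cornerInversion p ν = 1 := by
      rw [sum_cornerInversion, hlow ∅ (by simp), Finset.prod_empty]
    rw [← h1]
    exact Finset.single_le_sum (fun ν _ => hnn ν) (Finset.mem_univ ν)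
  · have h := vertexProj_cornerInversion_congr (p := p) (p' := fun F => ∏ i ∈ F, u i) (K := K)
      (fun F hF => hlow F ((Finset.card_le_card hF).trans hK.le)) μ
    rw [← unifVertex_eq_cornerInversion] at h
    simpa [vertexProj, Finset.sum_sub_distrib, sub_eq_zero] using h

lemma inversionWeight_eq (F : Face r) (ν : Vertex r) :
    inversionWeight F ν =
      if zeroFace ν ⊆ F then (-1 : ℝ) ^ (F.card - (zeroFace ν).card) else 0 := by
  split_ifs with h
  · rw [← Finset.card_sdiff_of_subset h, ← Finset.prod_const, inversionWeight,
      ← Finset.prod_subset (Finset.subset_univ (F \ zeroFace ν))]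
    · refine Finset.prod_congr rfl fun i hi => ?_
      simp only [Finset.mem_sdiff, mem_zeroFace, Bool.not_eq_false] at hi
      simp [hi.1, hi.2]
    · intro i _ hi
      have := @h i
      simp only [mem_zeroFace, Finset.mem_sdiff, not_and, Bool.not_eq_false] at hi this
      by_cases h1 : i ∈ F <;> cases h2 : ν i <;> simp_all
  · obtain ⟨i, hi, hiF⟩ := Finset.not_subset.1 h
    exact Finset.prod_eq_zero (Finset.mem_univ i) (by simp [hiF, mem_zeroFace.1 hi])

lemma cornerInversion_eq_sum_filter (p : Face r → ℝ) (ν : Vertex r) :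
    cornerInversion p ν =
      ∑ F ∈ Finset.univ.filter (fun F : Face r => zeroFace ν ⊆ F),
        (-1 : ℝ) ^ (F.card - (zeroFace ν).card) * p F := by
  rw [cornerInversion, Finset.sum_filter]
  refine Finset.sum_congr rfl fun F _ => ?_
  rw [inversionWeight_eq]
  split_ifs <;> ring

lemma cornerInversion_one_nonneg (ν : Vertex r) : 0 ≤ cornerInversion (fun _ => 1) ν := by
  have h : (fun _ : Face r => (1 : ℝ)) = fun F => ∏ i ∈ F, (fun _ : Fin r => (1 : ℝ)) i := by
    simp
  rw [h, ← unifVertex_eq_cornerInversion]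
  exact Finset.prod_nonneg fun i _ => by split_ifs <;> simp

/-- For small `q` the inversion of `F ↦ α F * q ^ b F` is non-negative: where `b` is increasing,
the term of smallest exponent dominates, and where `b` is eventually constant, the power of `q`
factors out. -/
lemma eventually_cornerInversion_nonneg {α b : Face r → ℝ} (hα : ∀ F, 0 < α F)
    (hb : ∀ F, IncreasingAt b F ∨ EventuallyConstAt b F)
    (halt : ∀ ν : Vertex r, EventuallyConstAt b (zeroFace ν) → 0 ≤ cornerInversion α ν) :
    ∀ᶠ q : ℝ in 𝓝[>] 0, ∀ ν, 0 ≤ cornerInversion (fun F => α F * q ^ b F) ν := by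
  rw [eventually_all]
  intro ν
  have key : ∀ q : ℝ, 0 < q → cornerInversion (fun F => α F * q ^ b F) ν =
      q ^ b (zeroFace ν) * ∑ F ∈ Finset.univ.filter (fun F : Face r => zeroFace ν ⊆ F),
        (-1 : ℝ) ^ (F.card - (zeroFace ν).card) * α F * q ^ (b F - b (zeroFace ν)) := by
    intro q hq
    rw [cornerInversion_eq_sum_filter, Finset.mul_sum]
    refine Finset.sum_congr rfl fun F _ => ?_
    rw [Real.rpow_sub hq]
    field_simp
  rcases hb (zeroFace ν) with hinc | hconst
  · have hlim : Tendsto (fun q : ℝ =>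
        ∑ F ∈ Finset.univ.filter (fun F : Face r => zeroFace ν ⊆ F),
          (-1 : ℝ) ^ (F.card - (zeroFace ν).card) * α F * q ^ (b F - b (zeroFace ν)))
        (𝓝[>] 0) (𝓝 (∑ F ∈ Finset.univ.filter (fun F : Face r => zeroFace ν ⊆ F),
          if F = zeroFace ν then α (zeroFace ν) else 0)) := by
      refine tendsto_finsetSum _ fun F hF => ?_
      simp only [Finset.mem_filter, Finset.mem_univ, true_and] at hF
      split_ifs with h
      · subst h
        simp
      · have hlt : 0 < b F - b (zeroFace ν) :=
          sub_pos.2 (hinc F (Finset.ssubset_iff_subset_ne.2 ⟨hF, Ne.symm h⟩))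
        have h0 : Tendsto (fun q : ℝ => q ^ (b F - b (zeroFace ν))) (𝓝[>] 0) (𝓝 0) := by
          have := (Real.continuousAt_rpow_const 0 (b F - b (zeroFace ν)) (Or.inr hlt.le)).tendsto
          rw [Real.zero_rpow hlt.ne'] at this
          exact this.mono_left nhdsWithin_le_nhds
        simpa using h0.const_mul ((-1 : ℝ) ^ (F.card - (zeroFace ν).card) * α F)
    rw [Finset.sum_ite_eq' _ _ (fun _ => α (zeroFace ν)), if_pos (by simp)] at hlim
    filter_upwards [hlim.eventually (lt_mem_nhds (hα _)), self_mem_nhdsWithin] with q hq hq0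
    rw [key q hq0]
    exact mul_nonneg (Real.rpow_nonneg (le_of_lt hq0) _) hq.le
  · filter_upwards [self_mem_nhdsWithin] with q hq0
    rw [key q hq0]
    refine mul_nonneg (Real.rpow_nonneg (le_of_lt hq0) _) ?_
    have h := halt ν hconst
    rw [cornerInversion_eq_sum_filter] at h
    refine h.trans_eq (Finset.sum_congr rfl fun F hF => ?_)
    simp only [Finset.mem_filter, Finset.mem_univ, true_and] at hF
    rcases eq_or_ne (zeroFace ν) F with h | h
    · simp [h]
    · rw [← hconst F (Finset.ssubset_iff_subset_ne.2 ⟨hF, h⟩), sub_self, Real.rpow_zero, mul_one]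

lemma vertexProj_nonneg {z : Vertex r → ℝ} (hz : ∀ ν, 0 ≤ z ν) (K : Face r) (μ : Vertex r) :
    0 ≤ vertexProj K z μ :=
  Finset.sum_nonneg fun ν _ => hz ν

lemma projTimesUnif_nonneg {u : Fin r → ℝ} (hu : ∀ i, u i ∈ Set.Ioo (0 : ℝ) 1)
    {z : Vertex r → ℝ} (hz : ∀ ν, 0 ≤ z ν) (A : Face r) (μ : Vertex r) :
    0 ≤ projTimesUnif A u z μ := by
  refine mul_nonneg (vertexProj_nonneg hz A μ) (Finset.prod_nonneg fun i _ => ?_)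
  have := hu i
  split_ifs <;> linarith [this.1, this.2]

lemma projTimesUnif_empty {z : Vertex r → ℝ} (hz : ∑ ν, z ν = 1) (u : Fin r → ℝ) :
    projTimesUnif ∅ u z = unifVertex u := by
  ext μ
  simp [projTimesUnif, vertexProj, hz, unifVertex]

/-- Projecting the product of a projection of `z` with the uniform copula further down to a
subface gives the projection of `z` onto that subface. -/
lemma vertexProj_projTimesUnif {F A : Face r} (hFA : F ⊆ A) (u : Fin r → ℝ) (z : Vertex r → ℝ)
    (κ : Vertex r) : vertexProj F (projTimesUnif A u z) κ = vertexProj F z κ := by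
  have h1 : ∀ ν' : Vertex r, (∑ ν ∈ Finset.univ.filter (fun ν : Vertex r => ∀ i ∈ A, ν i = ν' i),
      ∏ i ∈ Aᶜ, if ν i then 1 - u i else u i) = 1 := by
    intro ν'
    have h := sum_filter_prod A ν' fun i x =>
      if i ∈ A then (1 : ℝ) else if x then 1 - u i else u i
    rw [Finset.prod_eq_one (s := Finset.univ) (fun i _ => by by_cases hi : i ∈ A <;> simp [hi])]
      at h
    refine Eq.trans (Finset.sum_congr rfl fun ν _ => ?_) h
    rw [← Finset.prod_subset (Finset.subset_univ Aᶜ) (fun i _ hi => by simp_all)]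
    exact Finset.prod_congr rfl fun i hi => by simp [Finset.mem_compl.1 hi]
  simp only [vertexProj, projTimesUnif, Finset.sum_mul]
  rw [Finset.sum_comm' (t' := Finset.univ.filter (fun ν' : Vertex r => ∀ i ∈ F, ν' i = κ i))
    (s' := fun ν' => Finset.univ.filter (fun ν : Vertex r => ∀ i ∈ A, ν i = ν' i))]
  · refine Finset.sum_congr rfl fun ν' _ => ?_
    rw [← Finset.mul_sum, h1, mul_one]
  · intro ν ν'
    simp only [Finset.mem_filter, Finset.mem_univ, true_and]
    constructor
    · rintro ⟨h, h'⟩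
      exact ⟨fun i hi => (h' i hi).symm, fun i hi => (h' i (hFA hi)).trans (h i hi)⟩
    · rintro ⟨h, h'⟩
      exact ⟨fun i hi => (h i (hFA hi)).trans (h' i hi), fun i hi => (h i hi).symm⟩

lemma sum_projTimesUnif {z : Vertex r → ℝ} (hz : ∑ ν, z ν = 1) (A : Face r) (u : Fin r → ℝ) :
    ∑ ν, projTimesUnif A u z ν = 1 := by
  simpa [vertexProj, hz] using
    vertexProj_projTimesUnif (Finset.empty_subset A) u z (fun _ => false)

/-! ### Subdividing a box -/

section Boxes

/-- Lower corner of the sub-box at the vertex `ν` of the box `[lo, hi]` divided according to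
`u`. -/
def subLo (u lo hi : Fin r → ℝ) (ν : Vertex r) (i : Fin r) : ℝ :=
  lo i + (if ν i then u i else 0) * (hi i - lo i)

/-- Upper corner of the sub-box at the vertex `ν` of the box `[lo, hi]` divided according to
`u`. -/
def subHi (u lo hi : Fin r → ℝ) (ν : Vertex r) (i : Fin r) : ℝ :=
  lo i + (if ν i then 1 else u i) * (hi i - lo i)

variable {u lo hi : Fin r → ℝ}

lemma le_subLo (hu : ∀ i, u i ∈ Set.Ioo (0 : ℝ) 1) (h : ∀ i, lo i < hi i) (ν : Vertex r)
    (i : Fin r) : lo i ≤ subLo u lo hi ν i := by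
  have h1 := sub_pos.2 (h i)
  have h2 := (hu i).1
  unfold subLo
  split_ifs
  · linarith [mul_pos h2 h1]
  · simp

lemma subHi_le (hu : ∀ i, u i ∈ Set.Ioo (0 : ℝ) 1) (h : ∀ i, lo i < hi i) (ν : Vertex r)
    (i : Fin r) : subHi u lo hi ν i ≤ hi i := by
  have h1 := sub_pos.2 (h i)
  have h2 := (hu i).2
  unfold subHi
  split_ifs
  · linarith
  · nlinarith

lemma subHi_sub_subLo (u lo hi : Fin r → ℝ) (ν : Vertex r) (i : Fin r) :
    subHi u lo hi ν i - subLo u lo hi ν i =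
      (if ν i then 1 - u i else u i) * (hi i - lo i) := by
  unfold subHi subLo
  split_ifs <;> ring

lemma side_pos (hu : ∀ i, u i ∈ Set.Ioo (0 : ℝ) 1) (ν : Vertex r) (i : Fin r) :
    0 < if ν i then 1 - u i else u i := by
  have := hu i
  split_ifs <;> linarith [this.1, this.2]

lemma subLo_lt_subHi (hu : ∀ i, u i ∈ Set.Ioo (0 : ℝ) 1) (h : ∀ i, lo i < hi i) (ν : Vertex r)
    (i : Fin r) : subLo u lo hi ν i < subHi u lo hi ν i := by
  rw [← sub_pos, subHi_sub_subLo]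
  exact mul_pos (side_pos hu ν i) (sub_pos.2 (h i))

lemma Icc_sub_subset (hu : ∀ i, u i ∈ Set.Ioo (0 : ℝ) 1) (h : ∀ i, lo i < hi i) (ν : Vertex r) :
    Set.Icc (subLo u lo hi ν) (subHi u lo hi ν) ⊆ Set.Icc lo hi :=
  Set.Icc_subset_Icc (le_subLo hu h ν) (subHi_le hu h ν)

lemma unifVertex_pos (hu : ∀ i, u i ∈ Set.Ioo (0 : ℝ) 1) (ν : Vertex r) : 0 < unifVertex u ν :=
  Finset.prod_pos fun i _ => side_pos hu ν i

lemma volume_Icc_ne_zero (h : ∀ i, lo i < hi i) : volume (Set.Icc lo hi) ≠ 0 := by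
  rw [Real.volume_Icc_pi, Finset.prod_ne_zero_iff]
  exact fun i _ => (ENNReal.ofReal_pos.2 (sub_pos.2 (h i))).ne'

lemma volume_Icc_ne_top : volume (Set.Icc lo hi) ≠ ⊤ :=
  isCompact_Icc.measure_ne_top

lemma volume_Icc_sub (hu : ∀ i, u i ∈ Set.Ioo (0 : ℝ) 1) (ν : Vertex r) :
    volume (Set.Icc (subLo u lo hi ν) (subHi u lo hi ν)) =
      ENNReal.ofReal (unifVertex u ν) * volume (Set.Icc lo hi) := by
  rw [Real.volume_Icc_pi, Real.volume_Icc_pi, unifVertex,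
    ENNReal.ofReal_prod_of_nonneg fun i _ => (side_pos hu ν i).le, ← Finset.prod_mul_distrib]
  refine Finset.prod_congr rfl fun i _ => ?_
  rw [subHi_sub_subLo, ENNReal.ofReal_mul (side_pos hu ν i).le]

lemma restrict_Icc_eq_add {x m y : ℝ} (hxm : x ≤ m) (hmy : m ≤ y) :
    (volume : Measure ℝ).restrict (Set.Icc x y) =
      volume.restrict (Set.Icc m y) + volume.restrict (Set.Icc x m) := by
  rw [add_comm, ← Measure.restrict_congr_set (Ioc_ae_eq_Icc (a := m) (b := y)),
    ← Set.Icc_union_Ioc_eq_Icc hxm hmy]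
  exact Measure.restrict_union
    (Set.disjoint_left.2 fun z hz hz' => (not_lt_of_ge hz.2) hz'.1) measurableSet_Ioc

lemma volume_restrict_Icc_pi (lo hi : Fin r → ℝ) :
    (volume : Measure (Fin r → ℝ)).restrict (Set.Icc lo hi) =
      Measure.pi fun i => volume.restrict (Set.Icc (lo i) (hi i)) := by
  rw [← Set.pi_univ_Icc, volume_pi, Measure.restrict_pi_pi]

lemma sum_restrict_sub (hu : ∀ i, u i ∈ Set.Ioo (0 : ℝ) 1) (h : ∀ i, lo i < hi i) :
    ∑ ν : Vertex r, (volume : Measure (Fin r → ℝ)).restrict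
      (Set.Icc (subLo u lo hi ν) (subHi u lo hi ν)) = volume.restrict (Set.Icc lo hi) := by
  rw [volume_restrict_Icc_pi lo hi]
  refine (Measure.pi_eq fun s _ => ?_).symm
  have h1 : ∀ i, (volume : Measure ℝ).restrict (Set.Icc (lo i) (hi i)) (s i) =
      ∑ x : Bool, (volume : Measure ℝ).restrict
        (Set.Icc (lo i + (if x then u i else 0) * (hi i - lo i))
          (lo i + (if x then 1 else u i) * (hi i - lo i))) (s i) := by
    intro i
    have h2 := sub_pos.2 (h i)
    have h3 := mul_pos (hu i).1 h2
    have h4 : u i * (hi i - lo i) ≤ hi i - lo i := mul_le_of_le_one_left h2.le (hu i).2.le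
    rw [restrict_Icc_eq_add (m := lo i + u i * (hi i - lo i)) (by linarith) (by linarith)]
    simp
  simp only [h1, Measure.coe_finsetSum, Finset.sum_apply, Finset.prod_univ_sum,
    Fintype.piFinset_univ]
  refine Finset.sum_congr rfl fun ν _ => ?_
  rw [volume_restrict_Icc_pi, Measure.pi_pi]
  rfl

/-- The uniform measure on a box is the mixture of the uniform measures on its sub-boxes. -/
lemma sum_unifVertex_mul_cond (hu : ∀ i, u i ∈ Set.Ioo (0 : ℝ) 1) (h : ∀ i, lo i < hi i)
    {E : Set (Fin r → ℝ)} (hE : MeasurableSet E) :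
    ∑ ν : Vertex r, ENNReal.ofReal (unifVertex u ν) *
      ProbabilityTheory.cond (volume : Measure (Fin r → ℝ))
        (Set.Icc (subLo u lo hi ν) (subHi u lo hi ν)) E =
      ProbabilityTheory.cond (volume : Measure (Fin r → ℝ)) (Set.Icc lo hi) E := by
  have h1 := congrArg (fun m : Measure (Fin r → ℝ) => m E) (sum_restrict_sub hu h)
  simp only [Measure.coe_finsetSum, Finset.sum_apply, Measure.restrict_apply hE] at h1
  rw [ProbabilityTheory.cond_apply measurableSet_Icc, Set.inter_comm, ← h1, Finset.mul_sum]
  refine Finset.sum_congr rfl fun ν _ => ?_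
  have h2 : ENNReal.ofReal (unifVertex u ν) ≠ 0 :=
    (ENNReal.ofReal_pos.2 (unifVertex_pos hu ν)).ne'
  rw [ProbabilityTheory.cond_apply measurableSet_Icc, volume_Icc_sub hu, Set.inter_comm,
    ENNReal.mul_inv (Or.inl h2) (Or.inl ENNReal.ofReal_ne_top), ← mul_assoc, ← mul_assoc,
    ENNReal.mul_inv_cancel h2 ENNReal.ofReal_ne_top, one_mul]

/-! ### One step of tail nesting -/

lemma BoxMeasure.toMeasure_apply (c : BoxMeasure r) (E : Set (Fin r → ℝ)) :
    c.toMeasure E = ∑ j, ENNReal.ofReal (c.mass j) *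
      ProbabilityTheory.cond (volume : Measure (Fin r → ℝ)) (Set.Icc (c.lo j) (c.hi j)) E := by
  simp [BoxMeasure.toMeasure]

lemma tnest_toMeasure_apply (u : Fin r → ℝ) (z : Vertex r → ℝ) (c : BoxMeasure r)
    (E : Set (Fin r → ℝ)) :
    (tnest u z c).toMeasure E =
      ∑ j, ∑ ν, ENNReal.ofReal (c.mass j * projTimesUnif (c.originCoords j) u z ν) *
        ProbabilityTheory.cond (volume : Measure (Fin r → ℝ))
          (Set.Icc (subLo u (c.lo j) (c.hi j) ν) (subHi u (c.lo j) (c.hi j) ν)) E := by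
  rw [BoxMeasure.toMeasure_apply]
  exact Fintype.sum_sigma _

lemma BoxMeasure.mem_originCoords {c : BoxMeasure r} {j : c.ι} {i : Fin r} :
    i ∈ c.originCoords j ↔ c.lo j i = 0 := by
  simp [BoxMeasure.originCoords]

/-- A family of non-degenerate boxes with non-negative masses, each edge of which either is
`[0, S]` or lies above `S`. -/
structure IsCornerGrid (c : BoxMeasure r) (S : ℝ) : Prop where
  pos : 0 < S
  lt : ∀ j i, c.lo j i < c.hi j i
  hi_eq : ∀ j i, c.lo j i = 0 → c.hi j i = S
  le_lo : ∀ j i, c.lo j i ≠ 0 → S ≤ c.lo j i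
  mass_nonneg : ∀ j, 0 ≤ c.mass j

lemma subLo_eq_zero_iff {S : ℝ} (hS : 0 < S) (hu : ∀ i, u i ∈ Set.Ioo (0 : ℝ) 1)
    (h : ∀ i, lo i < hi i) (hlo : ∀ i, lo i ≠ 0 → S ≤ lo i) (ν : Vertex r) (i : Fin r) :
    subLo u lo hi ν i = 0 ↔ lo i = 0 ∧ ν i = false := by
  constructor
  · intro h0
    have h1 : lo i = 0 := by
      by_contra hne
      linarith [hlo i hne, le_subLo hu h ν i]
    refine ⟨h1, ?_⟩
    by_contra h2
    rw [Bool.not_eq_false] at h2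
    have h3 := mul_pos (hu i).1 (sub_pos.2 (h i))
    simp only [subLo, h2, if_true] at h0
    linarith
  · rintro ⟨h1, h2⟩
    simp [subLo, h1, h2]

lemma isCornerGrid_vertexBoxMeasure {q : ℝ} (hq : q ∈ Set.Ioo (0 : ℝ) 1) {z : Vertex r → ℝ}
    (hz : ∀ ν, 0 ≤ z ν) : IsCornerGrid (vertexBoxMeasure (fun _ : Fin r => q) z) q where
  pos := hq.1
  lt ν i := by
    have h1 := hq.1
    have h2 := hq.2
    simp only [vertexBoxMeasure]
    split_ifs <;> assumption
  hi_eq ν i h := by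
    simp only [vertexBoxMeasure] at h ⊢
    split_ifs at h ⊢
    · exact absurd h hq.1.ne'
    · rfl
  le_lo ν i h := by
    simp only [vertexBoxMeasure] at h ⊢
    split_ifs at h ⊢
    · exact le_rfl
    · exact absurd rfl h
  mass_nonneg := hz

lemma IsCornerGrid.tnest {c : BoxMeasure r} {S : ℝ} (hc : IsCornerGrid c S) {q : ℝ}
    (hq : q ∈ Set.Ioo (0 : ℝ) 1) {z : Vertex r → ℝ} (hz : ∀ ν, 0 ≤ z ν) :
    IsCornerGrid (tnest (fun _ => q) z c) (q * S) where
  pos := mul_pos hq.1 hc.pos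
  lt p i := subLo_lt_subHi (fun _ => hq) (hc.lt p.1) p.2 i
  hi_eq p i h := by
    obtain ⟨h1, h2⟩ :=
      (subLo_eq_zero_iff hc.pos (fun _ => hq) (hc.lt p.1) (hc.le_lo p.1) p.2 i).1 h
    change subHi (fun _ => q) (c.lo p.1) (c.hi p.1) p.2 i = q * S
    simp [subHi, h1, h2, hc.hi_eq p.1 i h1]
  le_lo p i h := by
    have h' := mt (subLo_eq_zero_iff hc.pos (fun _ => hq) (hc.lt p.1) (hc.le_lo p.1) p.2 i).2 h
    change q * S ≤ subLo (fun _ => q) (c.lo p.1) (c.hi p.1) p.2 i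
    by_cases h1 : c.lo p.1 i = 0
    · have h2 : p.2 i = true := by simpa [h1] using h'
      simp [subLo, h1, h2, hc.hi_eq p.1 i h1]
    · have h3 := hc.le_lo p.1 i h1
      have h4 := le_subLo (fun _ => hq) (hc.lt p.1) p.2 i
      have h5 : q * S ≤ S := mul_le_of_le_one_left hc.pos.le hq.2.le
      linarith
  mass_nonneg p := mul_nonneg (hc.mass_nonneg p.1) (projTimesUnif_nonneg (fun _ => hq) hz _ _)

/-- Tail nesting changes the measure only close to the faces through the origin: a box that does
not meet the region `x i ≤ S` for any `i` is divided uniformly. -/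
lemma IsCornerGrid.tnest_toMeasure_apply_of_subset {c : BoxMeasure r} {S : ℝ}
    (hc : IsCornerGrid c S) (hu : ∀ i, u i ∈ Set.Ioo (0 : ℝ) 1) {z : Vertex r → ℝ}
    (hz1 : ∑ ν, z ν = 1) {E : Set (Fin r → ℝ)}
    (hE : MeasurableSet E) (hES : E ⊆ {x | ∀ i, S < x i}) :
    (TailNest.tnest u z c).toMeasure E = c.toMeasure E := by
  rw [tnest_toMeasure_apply, BoxMeasure.toMeasure_apply]
  refine Finset.sum_congr rfl fun j _ => ?_
  by_cases hA : c.originCoords j = ∅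
  · rw [hA, projTimesUnif_empty hz1, ← sum_unifVertex_mul_cond hu (hc.lt j) hE, Finset.mul_sum]
    refine Finset.sum_congr rfl fun ν _ => ?_
    rw [ENNReal.ofReal_mul (hc.mass_nonneg j), mul_assoc]
  · obtain ⟨i, hi⟩ := Finset.nonempty_iff_ne_empty.2 hA
    have h0 : Set.Icc (c.lo j) (c.hi j) ∩ E = ∅ := by
      refine Set.eq_empty_of_forall_notMem fun x hx => ?_
      have h1 := hx.1.2 i
      rw [hc.hi_eq j i (BoxMeasure.mem_originCoords.1 hi)] at h1
      exact absurd (hES hx.2 i) (not_lt.2 h1)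
    have h1 : ∀ ν, Set.Icc (subLo u (c.lo j) (c.hi j) ν) (subHi u (c.lo j) (c.hi j) ν) ∩ E = ∅ :=
      fun ν => Set.subset_eq_empty
        (Set.inter_subset_inter_left E (Icc_sub_subset hu (hc.lt j) ν)) h0
    simp [ProbabilityTheory.cond_apply measurableSet_Icc, h0, h1]

/-- `G` is up to null sets a union of boxes of `c`. -/
def Resolves (c : BoxMeasure r) (G : Set (Fin r → ℝ)) : Prop :=
  ∀ j, Set.Icc (c.lo j) (c.hi j) ⊆ G ∨ volume (Set.Icc (c.lo j) (c.hi j) ∩ G) = 0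

lemma IsCornerGrid.resolves_tnest {c : BoxMeasure r} {S : ℝ} (hc : IsCornerGrid c S)
    (hu : ∀ i, u i ∈ Set.Ioo (0 : ℝ) 1) (z : Vertex r → ℝ) {G : Set (Fin r → ℝ)}
    (hG : Resolves c G) : Resolves (TailNest.tnest u z c) G := fun p =>
  (hG p.1).imp (fun h => (Icc_sub_subset hu (hc.lt p.1) p.2).trans h) fun h =>
    measure_mono_null (Set.inter_subset_inter_left G (Icc_sub_subset hu (hc.lt p.1) p.2)) h

lemma cond_Icc_eq_one (h : ∀ i, lo i < hi i) {G : Set (Fin r → ℝ)} (hG : Set.Icc lo hi ⊆ G) :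
    ProbabilityTheory.cond (volume : Measure (Fin r → ℝ)) (Set.Icc lo hi) G = 1 := by
  rw [ProbabilityTheory.cond_apply measurableSet_Icc, Set.inter_eq_left.2 hG]
  exact ENNReal.inv_mul_cancel (volume_Icc_ne_zero h) volume_Icc_ne_top

lemma cond_Icc_eq_zero {G : Set (Fin r → ℝ)} (hG : volume (Set.Icc lo hi ∩ G) = 0) :
    ProbabilityTheory.cond (volume : Measure (Fin r → ℝ)) (Set.Icc lo hi) G = 0 := by
  rw [ProbabilityTheory.cond_apply measurableSet_Icc, hG, mul_zero]

/-- Tail nesting keeps the mass of every box. -/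
lemma IsCornerGrid.tnest_toMeasure_apply_of_resolves {c : BoxMeasure r} {S : ℝ}
    (hc : IsCornerGrid c S) (hu : ∀ i, u i ∈ Set.Ioo (0 : ℝ) 1) {z : Vertex r → ℝ}
    (hz : ∀ ν, 0 ≤ z ν) (hz1 : ∑ ν, z ν = 1) {G : Set (Fin r → ℝ)} (hG : Resolves c G) :
    (TailNest.tnest u z c).toMeasure G = c.toMeasure G := by
  rw [tnest_toMeasure_apply, BoxMeasure.toMeasure_apply]
  refine Finset.sum_congr rfl fun j _ => ?_
  rcases hG j with h | h
  · rw [cond_Icc_eq_one (hc.lt j) h, mul_one, ← mul_one (c.mass j)]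
    nth_rw 2 [← sum_projTimesUnif hz1 (c.originCoords j) u]
    rw [Finset.mul_sum, ENNReal.ofReal_sum_of_nonneg fun ν _ =>
        mul_nonneg (hc.mass_nonneg j) (projTimesUnif_nonneg hu hz _ ν)]
    refine Finset.sum_congr rfl fun ν _ => ?_
    rw [cond_Icc_eq_one (subLo_lt_subHi hu (hc.lt j) ν)
      ((Icc_sub_subset hu (hc.lt j) ν).trans h), mul_one, mul_one]
  · rw [cond_Icc_eq_zero h, mul_zero, Finset.sum_eq_zero]
    intro ν _
    rw [cond_Icc_eq_zero (measure_mono_null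
      (Set.inter_subset_inter_left G (Icc_sub_subset hu (hc.lt j) ν)) h), mul_zero]

/-! ### Corner masses -/

/-- Total mass of the boxes that are boxes at the origin in all coordinates of `F`. -/
def cornerMass (c : BoxMeasure r) (F : Face r) : ℝ :=
  ∑ j, if F ⊆ c.originCoords j then c.mass j else 0

/-- The points with coordinates in `[0, S]` on the face `F`. -/
def corner (F : Face r) (S : ℝ) : Set (Fin r → ℝ) :=
  {x | ∀ i ∈ F, x i ∈ Set.Icc 0 S}

lemma measurableSet_corner (F : Face r) (S : ℝ) : MeasurableSet (corner F S) := by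
  simp only [corner, Set.ofPred_forall]
  exact MeasurableSet.iInter fun i => MeasurableSet.iInter fun _ =>
    measurable_pi_apply i measurableSet_Icc

lemma volume_eq_const (i : Fin r) (S : ℝ) : volume {x : Fin r → ℝ | x i = S} = 0 := by
  rw [volume_pi]
  exact Measure.pi_hyperplane (fun _ : Fin r => (volume : Measure ℝ)) i S

/-- The boxes at the origin in the coordinates of `F` lie in the corner, the others meet it in a
null set. As no box has negative coordinates, `G` need not include the bounds `0 ≤ x i`. -/
lemma IsCornerGrid.toMeasure_eq_cornerMass {c : BoxMeasure r} {S : ℝ} (hc : IsCornerGrid c S)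
    {F : Face r} {G : Set (Fin r → ℝ)} (hG : corner F S ⊆ G)
    (hG' : G ⊆ {x | ∀ i ∈ F, x i ≤ S}) :
    Resolves c G ∧ c.toMeasure G = ENNReal.ofReal (cornerMass c F) := by
  classical
  have h1 : ∀ j, F ⊆ c.originCoords j → Set.Icc (c.lo j) (c.hi j) ⊆ G := by
    intro j hF
    refine subset_trans (fun x hx => ?_) hG
    intro i hi
    have h0 := BoxMeasure.mem_originCoords.1 (hF hi)
    exact ⟨h0 ▸ hx.1 i, hc.hi_eq j i h0 ▸ hx.2 i⟩
  have h2 : ∀ j, ¬ F ⊆ c.originCoords j → volume (Set.Icc (c.lo j) (c.hi j) ∩ G) = 0 := by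
    intro j hF
    obtain ⟨i, hi, hi'⟩ := Finset.not_subset.1 hF
    refine measure_mono_null (fun x hx => ?_) (volume_eq_const i S)
    exact le_antisymm (hG' hx.2 i hi)
      ((hc.le_lo j i (mt BoxMeasure.mem_originCoords.2 hi')).trans (hx.1.1 i))
  refine ⟨fun j => ?_, ?_⟩
  · by_cases h : F ⊆ c.originCoords j
    · exact Or.inl (h1 j h)
    · exact Or.inr (h2 j h)
  · rw [BoxMeasure.toMeasure_apply, cornerMass, ENNReal.ofReal_sum_of_nonneg]
    · refine Finset.sum_congr rfl fun j _ => ?_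
      split_ifs with h
      · rw [cond_Icc_eq_one (hc.lt j) (h1 j h), mul_one]
      · rw [cond_Icc_eq_zero (h2 j h), mul_zero, ENNReal.ofReal_zero]
    · intro j _
      split_ifs
      · exact hc.mass_nonneg j
      · exact le_rfl

lemma cornerMass_vertexBoxMeasure {q : ℝ} (hq : 0 < q) (z : Vertex r → ℝ) (F : Face r) :
    cornerMass (vertexBoxMeasure (fun _ : Fin r => q) z) F = vertexProj F z fun _ => false := by
  unfold cornerMass vertexProj
  rw [Finset.sum_filter]
  refine Finset.sum_congr rfl fun (ν : Vertex r) _ => if_congr ?_ rfl rfl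
  refine forall_congr' fun i => imp_congr_right fun _ => ?_
  refine BoxMeasure.mem_originCoords.trans ?_
  simp [vertexBoxMeasure, hq.ne']

/-- Tail nesting multiplies the corner mass on each face `F` by the mass which the projection of
the nested vertex copula onto `F` has at the origin. -/
lemma IsCornerGrid.cornerMass_tnest {c : BoxMeasure r} {S : ℝ} (hc : IsCornerGrid c S)
    (hu : ∀ i, u i ∈ Set.Ioo (0 : ℝ) 1) (z : Vertex r → ℝ) (F : Face r) :
    cornerMass (TailNest.tnest u z c) F = cornerMass c F * vertexProj F z fun _ => false := by
  have h : ∀ (j : c.ι) (ν : Vertex r), F ⊆ (TailNest.tnest u z c).originCoords ⟨j, ν⟩ ↔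
      F ⊆ c.originCoords j ∧ ∀ i ∈ F, ν i = false := by
    intro j ν
    have h0 : ∀ i, i ∈ (TailNest.tnest u z c).originCoords ⟨j, ν⟩ ↔
        i ∈ c.originCoords j ∧ ν i = false := by
      intro i
      refine BoxMeasure.mem_originCoords.trans ?_
      rw [BoxMeasure.mem_originCoords]
      exact subLo_eq_zero_iff hc.pos hu (hc.lt j) (hc.le_lo j) ν i
    simp only [Finset.subset_iff, h0]
    exact forall₂_and
  have hsum : cornerMass (TailNest.tnest u z c) F =
      ∑ j, ∑ ν : Vertex r, if F ⊆ c.originCoords j ∧ ∀ i ∈ F, ν i = false then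
        c.mass j * projTimesUnif (c.originCoords j) u z ν else 0 :=
    (Fintype.sum_sigma _).trans <| Finset.sum_congr rfl fun j _ =>
      Finset.sum_congr rfl fun (ν : Vertex r) _ => if_congr (h j ν) rfl rfl
  rw [hsum, cornerMass, Finset.sum_mul]
  refine Finset.sum_congr rfl fun j _ => ?_
  by_cases hF : F ⊆ c.originCoords j
  · simp only [hF, true_and, if_true]
    rw [← vertexProj_projTimesUnif hF u z, vertexProj, Finset.sum_filter, Finset.mul_sum]
    refine Finset.sum_congr rfl fun ν _ => ?_
    rw [mul_ite, mul_zero]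
  · simp [hF]

end Boxes

/-! ### Iterated tail nesting -/

section Iteration

variable {q : ℕ → ℝ} {z : ℕ → Vertex r → ℝ}

lemma isCornerGrid_tnestIter (hq : ∀ n, q n ∈ Set.Ioo (0 : ℝ) 1) (hz : ∀ n ν, 0 ≤ z n ν) (n : ℕ) :
    IsCornerGrid (tnestIter (fun n _ => q n) z n) (∏ i ∈ Finset.range (n + 1), q i) := by
  induction n with
  | zero => simpa [tnestIter] using isCornerGrid_vertexBoxMeasure (hq 0) (hz 0)
  | succ n ih =>
    rw [Finset.prod_range_succ, mul_comm]
    exact ih.tnest (hq (n + 1)) (hz (n + 1))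

lemma cornerMass_tnestIter (hq : ∀ n, q n ∈ Set.Ioo (0 : ℝ) 1) (hz : ∀ n ν, 0 ≤ z n ν)
    (F : Face r) (n : ℕ) :
    cornerMass (tnestIter (fun n _ => q n) z n) F =
      ∏ i ∈ Finset.range (n + 1), vertexProj F (z i) fun _ => false := by
  induction n with
  | zero => simpa [tnestIter] using cornerMass_vertexBoxMeasure (hq 0).1 (z 0) F
  | succ n ih =>
    rw [Finset.prod_range_succ, ← ih]
    exact (isCornerGrid_tnestIter hq hz n).cornerMass_tnest (fun _ => hq (n + 1)) (z (n + 1)) F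

lemma toMeasure_tnestIter_corner (hq : ∀ n, q n ∈ Set.Ioo (0 : ℝ) 1) (hz : ∀ n ν, 0 ≤ z n ν)
    (hz1 : ∀ n, ∑ ν, z n ν = 1) (F : Face r) {n m : ℕ} (hnm : n ≤ m) :
    (tnestIter (fun n _ => q n) z m).toMeasure (corner F (∏ i ∈ Finset.range (n + 1), q i)) =
      ENNReal.ofReal (∏ i ∈ Finset.range (n + 1), vertexProj F (z i) fun _ => false) := by
  suffices h : Resolves (tnestIter (fun n _ => q n) z m)
      (corner F (∏ i ∈ Finset.range (n + 1), q i)) ∧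
      (tnestIter (fun n _ => q n) z m).toMeasure (corner F (∏ i ∈ Finset.range (n + 1), q i)) =
      ENNReal.ofReal (cornerMass (tnestIter (fun n _ => q n) z n) F) by
    rw [h.2, cornerMass_tnestIter hq hz]
  induction m, hnm using Nat.le_induction with
  | base =>
    exact (isCornerGrid_tnestIter hq hz n).toMeasure_eq_cornerMass subset_rfl
      fun x hx i hi => (hx i hi).2
  | succ m _ ih =>
    have hc := isCornerGrid_tnestIter hq hz m
    exact ⟨hc.resolves_tnest (fun _ => hq (m + 1)) (z (m + 1)) ih.1,
      (hc.tnest_toMeasure_apply_of_resolves (fun _ => hq (m + 1)) (hz (m + 1)) (hz1 (m + 1))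
        ih.1).trans ih.2⟩

lemma antitone_prod_range (hq : ∀ n, q n ∈ Set.Ioo (0 : ℝ) 1) :
    Antitone fun n => ∏ i ∈ Finset.range (n + 1), q i := by
  refine antitone_nat_of_succ_le fun n => ?_
  rw [Finset.prod_range_succ]
  exact mul_le_of_le_one_right (Finset.prod_nonneg fun i _ => (hq i).1.le) (hq (n + 1)).2.le

lemma toMeasure_tnestIter_eq (hq : ∀ n, q n ∈ Set.Ioo (0 : ℝ) 1) (hz : ∀ n ν, 0 ≤ z n ν)
    (hz1 : ∀ n, ∑ ν, z n ν = 1) {n m : ℕ} (hnm : n ≤ m) {E : Set (Fin r → ℝ)}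
    (hE : MeasurableSet E) (hES : E ⊆ {x | ∀ i, (∏ j ∈ Finset.range (n + 1), q j) < x i}) :
    (tnestIter (fun n _ => q n) z m).toMeasure E =
      (tnestIter (fun n _ => q n) z n).toMeasure E := by
  induction m, hnm using Nat.le_induction with
  | base => rfl
  | succ m hm ih =>
    rw [← ih]
    exact (isCornerGrid_tnestIter hq hz m).tnest_toMeasure_apply_of_subset (fun _ => hq (m + 1))
      (hz1 (m + 1)) hE fun x hx i => (antitone_prod_range hq hm).trans_lt (hES hx i)

end Iteration

/-- Measures that stabilize on an increasing sequence of sets, and whose masses outside of these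
sets tend to zero, converge on every measurable set to a measure. -/
lemma exists_tendsto_measure {α : Type*} [MeasurableSpace α] (μ : ℕ → Measure α)
    {U : ℕ → Set α} (hUm : ∀ n, MeasurableSet (U n)) (hU : Monotone U)
    (hμ : ∀ n m, n ≤ m → ∀ E, MeasurableSet E → E ⊆ U n → μ m E = μ n E)
    (h0 : Tendsto (fun n => μ n (U n)ᶜ) atTop (𝓝 0)) :
    ∃ c : Measure α, ∀ E, MeasurableSet E → Tendsto (fun n => μ n E) atTop (𝓝 (c E)) := by
  have hDm : ∀ n, MeasurableSet (disjointed U n) := fun n => .disjointed hUm n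
  -- The limit is glued from the pieces of `U n` on which the measures have stabilized.
  let c : Measure α := Measure.sum fun n => (μ n).restrict (disjointed U n)
  have hc : ∀ E, MeasurableSet E → c E = ∑' n, μ n (E ∩ disjointed U n) := by
    intro E hE
    rw [Measure.sum_apply _ hE]
    exact tsum_congr fun n => Measure.restrict_apply hE
  have hunion : ∀ E : Set α, MeasurableSet E → ∀ ν : Measure α,
      ν (E ∩ ⋃ n, U n) = ∑' n, ν (E ∩ disjointed U n) := by
    intro E hE ν
    rw [← iUnion_disjointed, Set.inter_iUnion]
    exact measure_iUnion (fun i j hij => ((disjoint_disjointed U) hij).mono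
      Set.inter_subset_right Set.inter_subset_right) fun n => hE.inter (hDm n)
  have hcU : ∀ n E, MeasurableSet E → c (E ∩ U n) = μ n (E ∩ U n) := by
    intro n E hE
    have hEU := hE.inter (hUm n)
    have h1 : E ∩ U n = (E ∩ U n) ∩ ⋃ m, U m :=
      (Set.inter_eq_left.2 (Set.inter_subset_right.trans (Set.subset_iUnion U n))).symm
    rw [hc _ hEU, h1, hunion _ hEU, ← h1]
    refine tsum_congr fun m => ?_
    rcases le_total n m with h | h
    · exact hμ n m h _ (hEU.inter (hDm m)) (Set.inter_subset_left.trans Set.inter_subset_right)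
    · exact (hμ m n h _ (hEU.inter (hDm m))
        (Set.inter_subset_right.trans (disjointed_subset U m))).symm
  have hcE : ∀ E, MeasurableSet E → Tendsto (fun n => c (E ∩ U n)) atTop (𝓝 (c E)) := by
    intro E hE
    have h1 : c E = c (⋃ n, E ∩ U n) := by
      rw [← Set.inter_iUnion, hc E hE, hc _ (hE.inter (MeasurableSet.iUnion hUm))]
      refine tsum_congr fun n => congrArg (μ n) ?_
      rw [Set.inter_assoc, Set.inter_eq_right.2
        ((disjointed_subset U n).trans (Set.subset_iUnion U n))]
    rw [h1]
    exact tendsto_measure_iUnion_atTop fun m n h => Set.inter_subset_inter_right E (hU h)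
  refine ⟨c, fun E hE => ?_⟩
  have h2 : Tendsto (fun n => c (E ∩ U n) + μ n (U n)ᶜ) atTop (𝓝 (c E)) := by
    simpa using (hcE E hE).add h0
  refine tendsto_of_tendsto_of_tendsto_of_le_of_le (hcE E hE) h2 (fun n => ?_) fun n => ?_
  · exact (hcU n E hE).trans_le (measure_mono Set.inter_subset_left)
  · simp only [hcU n E hE]
    rw [← measure_inter_add_sdiff E (hUm n)]
    gcongr
    exact fun x hx => hx.2

lemma measurableSet_forall_lt (S : ℝ) : MeasurableSet {x : Fin r → ℝ | ∀ i, S < x i} := by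
  simp only [Set.ofPred_forall]
  exact MeasurableSet.iInter fun i => measurable_pi_apply i measurableSet_Ioi

/-- The mass near the faces through the origin is at most the sum of the corner masses on the
edges, so if these tend to `0`, then the iterated tail nestings converge. -/
lemma exists_isTailNesting {q : ℕ → ℝ} {z : ℕ → Vertex r → ℝ}
    (hq : ∀ n, q n ∈ Set.Ioo (0 : ℝ) 1) (hz : ∀ n ν, 0 ≤ z n ν) (hz1 : ∀ n, ∑ ν, z n ν = 1)
    (h0 : ∀ i : Fin r, Tendsto (fun n => ∏ j ∈ Finset.range (n + 1),
      vertexProj {i} (z j) fun _ => false) atTop (𝓝 0)) :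
    ∃ c, IsTailNesting (fun n _ => q n) z c := by
  refine exists_tendsto_measure (fun n => (tnestIter (fun n _ => q n) z n).toMeasure)
    (U := fun n => {x | ∀ i, (∏ j ∈ Finset.range (n + 1), q j) < x i})
    (fun n => measurableSet_forall_lt _)
    (fun n m h x hx i => (antitone_prod_range hq h).trans_lt (hx i))
    (fun n m h E hE hEU => toMeasure_tnestIter_eq hq hz hz1 h hE hEU) ?_
  have hlim : Tendsto (fun n => ∑ i : Fin r, ENNReal.ofReal (∏ j ∈ Finset.range (n + 1),
      vertexProj {i} (z j) fun _ => false)) atTop (𝓝 0) := by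
    simpa using tendsto_finsetSum Finset.univ fun i _ =>
      (ENNReal.continuous_ofReal.tendsto 0).comp (h0 i)
  refine tendsto_of_tendsto_of_tendsto_of_le_of_le tendsto_const_nhds hlim
    (fun n => zero_le) fun n => ?_
  have hsub : {x : Fin r → ℝ | ∀ i, (∏ j ∈ Finset.range (n + 1), q j) < x i}ᶜ ⊆
      ⋃ i : Fin r, {x | ∀ l ∈ ({i} : Face r), x l ≤ ∏ j ∈ Finset.range (n + 1), q j} := by
    intro x hx
    obtain ⟨i, hi⟩ := not_forall.1 hx
    refine Set.mem_iUnion.2 ⟨i, fun l hl => ?_⟩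
    rw [Finset.mem_singleton.1 hl]
    exact not_lt.1 hi
  refine (measure_mono hsub).trans ((measure_iUnion_fintype_le _ _).trans
    (Finset.sum_le_sum fun i _ => ?_))
  rw [← cornerMass_tnestIter hq hz]
  exact ((isCornerGrid_tnestIter hq hz n).toMeasure_eq_cornerMass
    (fun x hx l hl => (hx l hl).2) subset_rfl).2.le

lemma IsTailNesting.apply_corner {q : ℕ → ℝ} {z : ℕ → Vertex r → ℝ} {c : Measure (Fin r → ℝ)}
    (hc : IsTailNesting (fun n _ => q n) z c)
    (hq : ∀ n, q n ∈ Set.Ioo (0 : ℝ) 1) (hz : ∀ n ν, 0 ≤ z n ν) (hz1 : ∀ n, ∑ ν, z n ν = 1)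
    (F : Face r) (n : ℕ) :
    c (corner F (∏ i ∈ Finset.range (n + 1), q i)) =
      ENNReal.ofReal (∏ i ∈ Finset.range (n + 1), vertexProj F (z i) fun _ => false) :=
  tendsto_nhds_unique (hc _ (measurableSet_corner F _)) <|
    tendsto_const_nhds.congr' <| (eventually_ge_atTop n).mono fun _ hm =>
      (toMeasure_tnestIter_corner hq hz hz1 F hm).symm

lemma tailMass_eq (c : Measure (Fin r → ℝ)) (F : Face r) (s : ℝ) :
    tailMass c F s = c (corner F s) := by
  rw [tailMass, faceMeasure, Measure.map_apply (by fun_prop) measurableSet_Icc]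
  congr 1
  ext x
  simp only [Set.mem_preimage, Set.mem_Icc, Pi.le_def, Subtype.forall, corner, Set.mem_ofPred_eq]
  exact ⟨fun h i hi => ⟨h.1 i hi, h.2 i hi⟩, fun h =>
    ⟨fun i hi => (h i hi).1, fun i hi => (h i hi).2⟩⟩

lemma tailMass_mono (c : Measure (Fin r → ℝ)) (F : Face r) : Monotone (tailMass c F) :=
  fun _ _ h => measure_mono (Set.Icc_subset_Icc le_rfl fun _ => h)

/-! ### Tail degrees -/

/-- If a monotone `f` is comparable to the power `b` along a sequence of scales whose successive
ratios are bounded away from `0`, then it is bounded below by that power at all small scales. -/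
lemma ofReal_rpow_le_of_monotone {f : ℝ → ℝ≥0∞} (hf : Monotone f) {T : ℕ → ℝ} {a b δ : ℝ}
    (ha : 0 < a) (hb : 0 ≤ b) (hδ : 0 < δ) (hT0 : Tendsto T atTop (𝓝 0))
    (hTδ : ∀ n, δ * T n ≤ T (n + 1)) (hfT : ∀ n, f (T n) = ENNReal.ofReal (a * T n ^ b))
    {s : ℝ} (hs : 0 < s) (hsT : s < T 0) : ENNReal.ofReal (a * (δ * s) ^ b) ≤ f s := by
  have hex : ∃ n, T n ≤ s := (hT0.eventually (ge_mem_nhds hs)).exists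
  classical
  obtain ⟨n, hn⟩ : ∃ n, Nat.find hex = n + 1 := Nat.exists_eq_succ_of_ne_zero fun h => by
    have := Nat.find_spec hex
    rw [h] at this
    exact absurd hsT (not_lt.2 this)
  have h1 : T (n + 1) ≤ s := hn ▸ Nat.find_spec hex
  have h2 : s < T n := not_le.1 (Nat.find_min hex (by omega))
  calc ENNReal.ofReal (a * (δ * s) ^ b) ≤ ENNReal.ofReal (a * T (n + 1) ^ b) := by
        gcongr
        exact (mul_le_mul_of_nonneg_left h2.le hδ.le).trans (hTδ n)
    _ = f (T (n + 1)) := (hfT _).symm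
    _ ≤ f s := hf h1

/-- The scales `T n` show that no exponent below `b` qualifies, and the lower bound of
`ofReal_rpow_le_of_monotone` that every exponent above `b` does. -/
lemma sInf_tail_eq {f : ℝ → ℝ≥0∞} (hf : Monotone f) {T : ℕ → ℝ} {a b δ : ℝ}
    (ha : 0 < a) (hb : 0 ≤ b) (hδ : 0 < δ) (hT : ∀ n, 0 < T n) (hT0 : Tendsto T atTop (𝓝 0))
    (hTδ : ∀ n, δ * T n ≤ T (n + 1)) (hfT : ∀ n, f (T n) = ENNReal.ofReal (a * T n ^ b)) :
    sInf {x : EReal | ∃ τ : ℝ, x = (τ : EReal) ∧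
      liminf (fun s : ℝ => f s / ENNReal.ofReal (s ^ τ)) (𝓝[>] 0) = ⊤} = (b : EReal) := by
  apply le_antisymm
  · refine EReal.le_of_forall_lt_iff_le.1 fun τ hτ => sInf_le ⟨τ, rfl, ?_⟩
    have hτ' : b < τ := EReal.coe_lt_coe_iff.1 hτ
    refine Tendsto.liminf_eq ?_
    have h1 : Tendsto (fun s : ℝ => ENNReal.ofReal (a * δ ^ b * s ^ (b - τ))) (𝓝[>] 0) (𝓝 ⊤) :=
      ENNReal.tendsto_ofReal_atTop.comp <| Tendsto.const_mul_atTop (by positivity) <|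
        tendsto_rpow_neg_nhdsGT_zero (sub_neg.2 hτ')
    refine tendsto_nhds_top_mono h1 ?_
    filter_upwards [Ioo_mem_nhdsGT (hT 0)] with s hs
    have hs0 : 0 < s := hs.1
    have h2 := ofReal_rpow_le_of_monotone hf ha hb hδ hT0 hTδ hfT hs0 hs.2
    rw [ENNReal.le_div_iff_mul_le (Or.inl (by positivity)) (Or.inl ENNReal.ofReal_ne_top),
      ← ENNReal.ofReal_mul (by positivity)]
    convert h2 using 2
    rw [Real.rpow_sub hs0, Real.mul_rpow hδ.le hs0.le]
    field_simp
  · refine le_sInf ?_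
    rintro _ ⟨τ, rfl, hτ⟩
    rw [EReal.coe_le_coe_iff]
    by_contra! hlt
    have h1 : ∀ᶠ s in 𝓝[>] 0, ENNReal.ofReal a < f s / ENNReal.ofReal (s ^ τ) :=
      eventually_lt_of_lt_liminf (hτ ▸ ENNReal.ofReal_lt_top)
    have hT0' : Tendsto T atTop (𝓝[>] 0) :=
      tendsto_nhdsWithin_iff.2 ⟨hT0, Eventually.of_forall hT⟩
    obtain ⟨n, hn, hn1⟩ := ((hT0'.eventually h1).and (hT0.eventually (ge_mem_nhds one_pos))).exists
    have hTn := hT n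
    refine absurd hn (not_lt.2 (ENNReal.div_le_of_le_mul ?_))
    rw [hfT, ← ENNReal.ofReal_mul ha.le]
    exact ENNReal.ofReal_le_ofReal
      (mul_le_mul_of_nonneg_left (Real.rpow_le_rpow_of_exponent_ge hTn hn1 hlt.le) ha.le)

/-! ### Scales -/

/-- A positive sequence with limit `0` has a subsequence that decreases at a given geometric
rate. -/
lemma exists_strictMono_mul_le {t : ℕ → ℝ} (ht : ∀ m, 0 < t m) (ht0 : Tendsto t atTop (𝓝 0))
    {ε : ℝ} (hε : 0 < ε) :
    ∃ φ : ℕ → ℕ, StrictMono φ ∧ t (φ 0) ≤ ε ∧ ∀ n, t (φ (n + 1)) ≤ ε * t (φ n) := by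
  obtain ⟨m0, hm0⟩ := (ht0.eventually (ge_mem_nhds hε)).exists
  have h : ∀ m, ∃ m', m < m' ∧ t m' ≤ ε * t m := fun m =>
    ((eventually_gt_atTop m).and (ht0.eventually (ge_mem_nhds (mul_pos hε (ht m))))).exists
  choose g hg hg' using h
  have hsucc : ∀ n, g^[n + 1] m0 = g (g^[n] m0) := fun n => Function.iterate_succ_apply' g n m0
  refine ⟨fun n => g^[n] m0, strictMono_nat_of_lt_succ fun n => ?_, hm0, fun n => ?_⟩
  · rw [hsucc]
    exact hg _
  · simp only [hsucc]
    exact hg' _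

/-- A sequence that decreases at least at the geometric rate `ε` can be interpolated by scales
whose successive ratios lie between `ε ^ 2` and `ε`. -/
lemma exists_ratios {t : ℕ → ℝ} (ht : ∀ m, 0 < t m) {ε : ℝ} (hε : ε ∈ Set.Ioo (0 : ℝ) 1)
    (h0 : t 0 ≤ ε) (hsucc : ∀ n, t (n + 1) ≤ ε * t n) :
    ∃ q : ℕ → ℝ, (∀ j, q j ∈ Set.Icc (ε ^ 2) ε) ∧
      ∀ n, ∃ j, t n = ∏ i ∈ Finset.range (j + 1), q i := by
  have hε0 := hε.1
  -- The state is the index of the next value of `t` to be hit, and the current scale. As long as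
  -- the next value is not within reach, the scale is multiplied by `ε`.
  let step : ℕ × ℝ → ℕ × ℝ := fun p =>
    if ε ^ 2 * p.2 ≤ t p.1 then (p.1 + 1, t p.1) else (p.1, ε * p.2)
  let P : ℕ → ℕ × ℝ := fun j => step^[j] (0, 1)
  have hP : ∀ j, P (j + 1) = step (P j) := fun j => Function.iterate_succ_apply' step j (0, 1)
  have hinv : ∀ j, 0 < (P j).2 ∧ t (P j).1 ≤ ε * (P j).2 := by
    intro j
    induction j with
    | zero => exact ⟨one_pos, by simpa [P] using h0⟩
    | succ j ih =>
      rw [hP]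
      by_cases h : ε ^ 2 * (P j).2 ≤ t (P j).1
      · simp only [step, if_pos h]
        exact ⟨ht _, hsucc _⟩
      · simp only [step, if_neg h]
        refine ⟨mul_pos hε0 ih.1, ?_⟩
        rw [← mul_assoc, ← sq]
        exact (not_le.1 h).le
  have hprod : ∀ j, ∏ i ∈ Finset.range j, (P (i + 1)).2 / (P i).2 = (P j).2 := by
    intro j
    induction j with
    | zero => rfl
    | succ j ih => rw [Finset.prod_range_succ, ih, mul_div_cancel₀ _ (hinv j).1.ne']
  have hreach : ∀ j, ∃ j', P (j' + 1) = ((P j).1 + 1, t (P j).1) := by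
    intro j
    by_contra! hne
    have h1 : ∀ m, P (j + m) = ((P j).1, ε ^ m * (P j).2) := by
      intro m
      induction m with
      | zero => simp
      | succ m ih =>
        have h2 := hne (j + m)
        rw [hP, ih] at h2
        rw [← add_assoc, hP, ih]
        by_cases h : ε ^ 2 * (ε ^ m * (P j).2) ≤ t (P j).1
        · simp [step, if_pos h] at h2
        · simp only [step, if_neg h]
          rw [pow_succ']
          ring_nf
    obtain ⟨m, hm⟩ := exists_pow_lt_of_lt_one (div_pos (ht (P j).1) (hinv j).1) hε.2
    have h2 := hne (j + m)
    rw [hP, h1] at h2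
    rw [lt_div_iff₀ (hinv j).1] at hm
    have h3 : ε ^ 2 * (ε ^ m * (P j).2) ≤ t (P j).1 :=
      (mul_le_of_le_one_left (mul_pos (pow_pos hε0 m) (hinv j).1).le
        (pow_le_one₀ hε0.le hε.2.le)).trans hm.le
    simp [step, if_pos h3] at h2
  have hhit : ∀ n, ∃ j, P (j + 1) = (n + 1, t n) := by
    intro n
    induction n with
    | zero => exact hreach 0
    | succ n ih =>
      obtain ⟨j, hj⟩ := ih
      simpa [hj] using hreach (j + 1)
  refine ⟨fun j => (P (j + 1)).2 / (P j).2, fun j => ?_, fun n => ?_⟩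
  · obtain ⟨h1, h2⟩ := hinv j
    rw [Set.mem_Icc, le_div_iff₀ h1, div_le_iff₀ h1, hP]
    by_cases h : ε ^ 2 * (P j).2 ≤ t (P j).1
    · simp only [step, if_pos h]
      exact ⟨h, h2⟩
    · simp only [step, if_neg h]
      refine ⟨?_, le_rfl⟩
      rw [sq, mul_assoc]
      exact mul_le_of_le_one_left (mul_pos hε0 h1).le hε.2.le
  · obtain ⟨j, hj⟩ := hhit n
    exact ⟨j, by rw [hprod, hj]⟩

end TailNest

end

theorem mainTheorem4 (r k : ℕ) (hk : 1 ≤ k) (hkr : k ≤ r)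
    (a b : TailNest.Face r → ℝ) (hab : TailNest.NC k a b)
    (hb : ∀ F, TailNest.IncreasingAt b F ∨ TailNest.EventuallyConstAt b F)
    (t : ℕ → ℝ) (ht : ∀ m, t m ∈ Set.Ioc (0 : ℝ) 1) (ht0 : Tendsto t atTop (𝓝 0)) :
    ∃ φ : ℕ → ℕ, StrictMono φ ∧
      ∃ (u : ℕ → Fin r → ℝ) (z : ℕ → TailNest.Vertex r → ℝ),
        (∀ n i, u n i ∈ Set.Ioo (0 : ℝ) 1) ∧
        (∀ n, z n ∈ TailNest.vertexCopulas k (u n)) ∧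
        ∃ c : Measure (Fin r → ℝ), TailNest.IsTailNesting u z c ∧
          (∀ F : TailNest.Face r,
            Tendsto (fun n => (TailNest.tailMass c F (t (φ n))).toReal / t (φ n) ^ b F)
              atTop (𝓝 (a F))) ∧
          ∀ F : TailNest.Face r, TailNest.tailDegree c F = (b F : EReal) := by
  have hev := (TailNest.eventually_cornerInversion_nonneg hab.pos hb fun ν h => by
      rw [TailNest.cornerInversion_eq_sum_filter]
      exact hab.alt _ h).and
    (TailNest.eventually_cornerInversion_nonneg (α := fun _ => 1) (fun _ => one_pos) hb fun ν _ =>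
      TailNest.cornerInversion_one_nonneg ν)
  obtain ⟨δ, hδ, hδ'⟩ := mem_nhdsGT_iff_exists_Ioo_subset.1 hev
  obtain ⟨ε, hε0, hε⟩ := exists_between (lt_min (Set.mem_Ioi.1 hδ) one_pos)
  have hε1 : ε ∈ Set.Ioo (0 : ℝ) 1 := ⟨hε0, hε.trans_le (min_le_right _ _)⟩
  obtain ⟨φ, hφ, hφ0, hφs⟩ := TailNest.exists_strictMono_mul_le (fun m => (ht m).1) ht0 hε0
  obtain ⟨q, hqε, hqt⟩ := TailNest.exists_ratios (fun m => (ht (φ m)).1) hε1 hφ0 hφs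
  have hq : ∀ n, q n ∈ Set.Ioo (0 : ℝ) 1 := fun n =>
    ⟨(pow_pos hε0 2).trans_le (hqε n).1, (hqε n).2.trans_lt hε1.2⟩
  have hqδ : ∀ n, q n ∈ Set.Ioo 0 δ := fun n =>
    ⟨(hq n).1, (hqε n).2.trans_lt (hε.trans_le (min_le_left _ _))⟩
  -- The factor `a F` enters in the first step only; later steps multiply the corner mass on `F`
  -- by the power `b F` of the ratio of the scales.
  let p : ℕ → TailNest.Face r → ℝ := fun n F => (if n = 0 then a F else 1) * q n ^ b F
  let z : ℕ → TailNest.Vertex r → ℝ := fun n => TailNest.cornerInversion (p n)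
  have hz : ∀ n ν, 0 ≤ z n ν := by
    intro n ν
    by_cases hn : n = 0
    · simpa [z, p, hn] using (hδ' (hqδ 0)).1 ν
    · simpa [z, p, hn] using (hδ' (hqδ n)).2 ν
  have hlow : ∀ n (F : TailNest.Face r), F.card ≤ k → p n F = ∏ _i ∈ F, q n := by
    intro n F hF
    obtain ⟨h1, h2⟩ := hab.low F hF
    simp [p, h1, h2]
  have hz1 : ∀ n, ∑ ν, z n ν = 1 := fun n => by
    rw [TailNest.sum_cornerInversion, hlow n ∅ (by simp), Finset.prod_empty]
  have hprod : ∀ F n, ∏ i ∈ Finset.range (n + 1),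
      TailNest.vertexProj F (z i) (fun _ => false) =
        a F * (∏ i ∈ Finset.range (n + 1), q i) ^ b F := by
    intro F n
    simp only [z, TailNest.vertexProj_cornerInversion_zero, p, Finset.prod_mul_distrib]
    rw [Finset.prod_range_succ', ← Real.finsetProd_rpow _ _ fun i _ => (hq i).1.le]
    simp
  have hS0 : ∀ n, 0 < ∏ i ∈ Finset.range (n + 1), q i := fun n =>
    Finset.prod_pos fun i _ => (hq i).1
  have hS : Tendsto (fun n => ∏ i ∈ Finset.range (n + 1), q i) atTop (𝓝 0) := by
    have h1 := (tendsto_pow_atTop_nhds_zero_of_lt_one hε0.le hε1.2).comp (tendsto_add_atTop_nat 1)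
    refine squeeze_zero (fun n => (hS0 n).le) (fun n => ?_) h1
    simpa using Finset.prod_le_prod (s := Finset.range (n + 1)) (fun i _ => (hq i).1.le)
      fun i _ => (hqε i).2
  have hb0 : ∀ F, 0 ≤ b F := fun F => by
    simpa [(hab.low ∅ (by simp)).2] using hab.mono ∅ F (Finset.empty_subset F)
  obtain ⟨c, hc⟩ := TailNest.exists_isTailNesting hq hz hz1 fun i => by
    obtain ⟨h1, h2⟩ := hab.low {i} (by simpa using hk)
    simpa [hprod, h1, h2] using hS
  have hmass : ∀ F n, TailNest.tailMass c F (∏ i ∈ Finset.range (n + 1), q i) =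
      ENNReal.ofReal (a F * (∏ i ∈ Finset.range (n + 1), q i) ^ b F) := fun F n => by
    rw [TailNest.tailMass_eq, hc.apply_corner hq hz hz1, hprod]
  refine ⟨φ, hφ, fun n _ => q n, z, fun n _ => hq n, fun n =>
    TailNest.cornerInversion_mem_vertexCopulas (hlow n) (hz n), c, hc, fun F => ?_, fun F => ?_⟩
  · refine tendsto_const_nhds.congr fun n => ?_
    obtain ⟨j, hj⟩ := hqt n
    have h1 := Real.rpow_pos_of_pos (hS0 j) (b F)
    rw [hj, hmass, ENNReal.toReal_ofReal (mul_pos (hab.pos F) h1).le,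
      mul_div_cancel_right₀ _ h1.ne']
  · refine TailNest.sInf_tail_eq (TailNest.tailMass_mono c F) (hab.pos F) (hb0 F) (pow_pos hε0 2)
      hS0 hS (fun n => ?_) (hmass F)
    rw [Finset.prod_range_succ _ (n + 1), mul_comm]
    exact mul_le_mul_of_nonneg_left (hqε (n + 1)).1 (hS0 n).le
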